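/- Let $K$ be an algebraically closed field of characteristic $0$ (for example $K=\mathbb{C}$), let $n\ge 1$, and let $\Lambda^2(V)$, $\dim V=2n$, be the space of skew-symmetric $2n\times 2n$ matrices over $K$. Let $\rho$ be the representation of the Lie algebra $\mathfrak{sl}(2n)$ of trace-zero $2n\times 2n$ matrices on $\Lambda^2(V)$ given by $\rho(X)Q = XQ+QX^{T}$ (the differential of the congruence action $(P,Q)\mapsto PQP^{T}$). For $Q\in\Lambda^2(V)$ let $R_Q:\mathfrak{sl}(2n)\to\Lambda^2(V)$ be the linear map $R_Q(X)=\rho(X)Q$. Then the Jordan–Kronecker invariant of $\rho$ consists of - $n(2n+1)$ horizontal indices, of which $3n$ are equal to $1$ and $2n(n-1)$ are equal to $2$; - one vertical index, equal to $n$; - no Jordan blocks. This means: there is a polynomial function $p\not\equiv 0$ on $\Lambda^2(V)\times\Lambda^2(V)$ such that for every pair $(Q,B)$ with $p(Q,B)\neq 0$ there are bases of $\mathfrak{sl}(2n)$ and $\Lambda^2(V)$ in which the matrices of the pencil $R_Q+\lambda R_B$ are block-diagonal, with exactly the following blocks on the diagonal: $3n$ blocks of size $0\times 1$ (zero columns),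 $2n(n-1)$ blocks $\begin{pmatrix}\lambda & 1\end{pmatrix}$ of size $1\times 2$, and one block of size $n\times(n-1)$ with entries $\lambda$ at the positions $(i,i)$, entries $1$ at the positions $(i+1,i)$, and zeros elsewhere. -/

import Mathlib

attribute [local instance 100] LieRing.ofAssociativeRing

noncomputable section

namespace JK

section Pencils

variable {K : Type*} [Field K]

/-- The blocks of the Jordan-Kronecker normal form of a pencil `A + lam * B`.
Sizes are shifted so that every value is an admissible block: `jordan ev k` and `jordanInf k` have
size `(k + 1) × (k + 1)`, `horizontal k` has size `k × (k + 1)` and `vertical k` has size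
`(k + 1) × k`. In particular `horizontal 0` is a zero column and `vertical 0` a zero row. -/
inductive Block (K : Type*) where
  | jordan (ev : K) (k : ℕ) : Block K
  | jordanInf (k : ℕ) : Block K
  | horizontal (k : ℕ) : Block K
  | vertical (k : ℕ) : Block K

/-- Number of rows of a block. -/
def Block.rows : Block K → ℕ
  | .jordan _ k => k + 1
  | .jordanInf k => k + 1
  | .horizontal k => k
  | .vertical k => k + 1

/-- Number of columns of a block. -/
def Block.cols : Block K → ℕ
  | .jordan _ k => k + 1
  | .jordanInf k => k + 1
  | .horizontal k => k + 1
  | .vertical k => k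

/-- The matrix with ones at the positions `(i, i)` and zeros elsewhere. -/
def diagOnes (K : Type*) [Field K] (r c : ℕ) : Matrix (Fin r) (Fin c) K :=
  Matrix.of fun i j => if (j : ℕ) = (i : ℕ) then 1 else 0

/-- The matrix with ones at the positions `(i, i + 1)` and zeros elsewhere. -/
def superOnes (K : Type*) [Field K] (r c : ℕ) : Matrix (Fin r) (Fin c) K :=
  Matrix.of fun i j => if (j : ℕ) = (i : ℕ) + 1 then 1 else 0

/-- The matrix with ones at the positions `(j + 1, j)` and zeros elsewhere. -/
def subOnes (K : Type*) [Field K] (r c : ℕ) : Matrix (Fin r) (Fin c) K :=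
  Matrix.of fun i j => if (i : ℕ) = (j : ℕ) + 1 then 1 else 0

/-- The matrix `A_i` of a block `A_i + lam * B_i`. -/
def Block.matA : (b : Block K) → Matrix (Fin b.rows) (Fin b.cols) K
  | .jordan ev k => ev • diagOnes K (k + 1) (k + 1) + superOnes K (k + 1) (k + 1)
  | .jordanInf k => diagOnes K (k + 1) (k + 1)
  | .horizontal k => superOnes K k (k + 1)
  | .vertical k => subOnes K (k + 1) k

/-- The matrix `B_i` of a block `A_i + lam * B_i`. -/
def Block.matB : (b : Block K) → Matrix (Fin b.rows) (Fin b.cols) K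
  | .jordan _ k => diagOnes K (k + 1) (k + 1)
  | .jordanInf k => superOnes K (k + 1) (k + 1)
  | .horizontal k => diagOnes K k (k + 1)
  | .vertical k => diagOnes K (k + 1) k

/-- Eigenvalue (possibly infinite) and size of a Jordan block. -/
def Block.jordanData : Block K → Option (OnePoint K × ℕ)
  | .jordan ev k => some ((ev : OnePoint K), k + 1)
  | .jordanInf k => some (OnePoint.infty, k + 1)
  | _ => none

/-- The horizontal index (width) of a horizontal Kronecker block. -/
def Block.horizontalIndex : Block K → Option ℕ
  | .horizontal k => some (k + 1)
  | _ => none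

/-- The vertical index (height) of a vertical Kronecker block. -/
def Block.verticalIndex : Block K → Option ℕ
  | .vertical k => some (k + 1)
  | _ => none

/-- The discrete invariants of a pencil. The multiset `jordan` has one entry for every distinct
eigenvalue, namely the multiset of the sizes of the Jordan blocks with this eigenvalue. -/
@[ext] structure AlgebraicType where
  jordan : Multiset (Multiset ℕ)
  horizontal : Multiset ℕ
  vertical : Multiset ℕ

/-- The discrete invariants of a multiset of blocks. -/
def algebraicTypeOfBlocks (s : Multiset (Block K)) : AlgebraicType :=
  letI : DecidableEq (OnePoint K) := Classical.decEq _
  { jordan := (((s.filterMap Block.jordanData).map Prod.fst).dedup).map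
      fun ev => ((s.filterMap Block.jordanData).filter fun d => d.1 = ev).map Prod.snd
    horizontal := s.filterMap Block.horizontalIndex
    vertical := s.filterMap Block.verticalIndex }

variable {U V : Type*} [AddCommGroup U] [Module K U] [AddCommGroup V] [Module K V]

/-- In suitable bases of `U` and `V` the matrices of `A` and `B` are block-diagonal,
with the given blocks of the Jordan-Kronecker normal form on the diagonal. -/
def IsNormalForm (A B : U →ₗ[K] V) {ι : Type} [Fintype ι] [DecidableEq ι]
    (blocks : ι → Block K) : Prop :=
  ∃ (bU : Module.Basis (Σ i, Fin (blocks i).cols) K U)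
    (bV : Module.Basis (Σ i, Fin (blocks i).rows) K V),
    LinearMap.toMatrix bU bV A = Matrix.blockDiagonal' (fun i => (blocks i).matA) ∧
    LinearMap.toMatrix bU bV B = Matrix.blockDiagonal' (fun i => (blocks i).matB)

/-- The pencil `A + lam * B` has algebraic type `τ`: it has a Jordan-Kronecker normal form with
the discrete invariants `τ`. -/
def HasAlgebraicType (A B : U →ₗ[K] V) (τ : AlgebraicType) : Prop :=
  ∃ (ι : Type) (_ : Fintype ι) (_ : DecidableEq ι) (blocks : ι → Block K),
    IsNormalForm A B blocks ∧
    algebraicTypeOfBlocks ((Finset.univ : Finset ι).val.map blocks) = τ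

end Pencils

section Representations

variable {K : Type*} [Field K]

/-- `P` holds for a generic point of the vector space `W`: it holds wherever some polynomial
function on `W`, not identically zero, does not vanish. -/
def Generic {W : Type*} [AddCommGroup W] [Module K W] (P : W → Prop) : Prop :=
  ∃ p : MvPolynomial (Module.Dual K W) K,
    (∃ w : W, MvPolynomial.eval (fun φ : Module.Dual K W => φ w) p ≠ 0) ∧
    ∀ w : W, MvPolynomial.eval (fun φ : Module.Dual K W => φ w) p ≠ 0 → P w

variable {𝔤 V : Type*} [LieRing 𝔤] [LieAlgebra K 𝔤] [AddCommGroup V] [Module K V]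

/-- The operator `R_x : 𝔤 → V`, `R_x ξ = ρ(ξ) x`. -/
def orbitMap (ρ : 𝔤 →ₗ⁅K⁆ Module.End K V) (x : V) : 𝔤 →ₗ[K] V :=
  (ρ : 𝔤 →ₗ[K] Module.End K V).flip x

/-- `τ` is the Jordan-Kronecker invariant of `ρ`: the algebraic type of the pencil
`R_a + lam * R_b` for a generic pair `(a, b)`. -/
def IsJKInvariant (ρ : 𝔤 →ₗ⁅K⁆ Module.End K V) (τ : AlgebraicType) : Prop :=
  Generic (K := K) fun w : V × V => HasAlgebraicType (orbitMap ρ w.1) (orbitMap ρ w.2) τ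

end Representations

section Congruence

variable (K : Type*) [Field K] (m : Type*) [Fintype m] [DecidableEq m]

/-- The space of skew-symmetric matrices (in characteristic different from 2, the matrices of
skew-symmetric forms). -/
def skewForms : Submodule K (Matrix m m K) where
  carrier := {Q | Q.transpose = -Q}
  zero_mem' := by simp
  add_mem' := by
    intro a b ha hb
    change (a + b).transpose = -(a + b)
    rw [Matrix.transpose_add, show a.transpose = -a from ha, show b.transpose = -b from hb, neg_add]
  smul_mem' := by
    intro c a ha
    change (c • a).transpose = -(c • a)
    rw [Matrix.transpose_smul, show a.transpose = -a from ha, smul_neg]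

/-- The congruence operator `Q ↦ X Q + Q Xᵀ` on skew-symmetric matrices. -/
def congOp (X : Matrix m m K) : Module.End K (skewForms K m) where
  toFun Q := ⟨X * (Q : Matrix m m K) + (Q : Matrix m m K) * X.transpose, by
    have h : (Q : Matrix m m K).transpose = -(Q : Matrix m m K) := Q.2
    change (X * (Q : Matrix m m K) + (Q : Matrix m m K) * X.transpose).transpose
      = -(X * (Q : Matrix m m K) + (Q : Matrix m m K) * X.transpose)
    rw [Matrix.transpose_add, Matrix.transpose_mul, Matrix.transpose_mul,
      Matrix.transpose_transpose, h]
    simp only [Matrix.neg_mul, Matrix.mul_neg]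
    abel⟩
  map_add' P Q := by
    apply Subtype.ext
    simp only [Submodule.coe_add, mul_add, add_mul]
    abel
  map_smul' c Q := by
    apply Subtype.ext
    simp

/-- The representation of `gl(m)` on skew-symmetric forms that is the differential of the
congruence action `P, Q ↦ P Q Pᵀ`. -/
def glCongruence : Matrix m m K →ₗ⁅K⁆ Module.End K (skewForms K m) where
  toFun := congOp K m
  map_add' X Y := by
    apply LinearMap.ext
    intro Q
    apply Subtype.ext
    simp only [congOp, LinearMap.coe_mk, AddHom.coe_mk, LinearMap.add_apply, Submodule.coe_add,
      Matrix.transpose_add, mul_add, add_mul]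
    abel
  map_smul' c X := by
    apply LinearMap.ext
    intro Q
    apply Subtype.ext
    simp [congOp]
  map_lie' := by
    intro X Y
    apply LinearMap.ext
    intro Q
    apply Subtype.ext
    simp only [congOp, Ring.lie_def, LinearMap.coe_mk, AddHom.coe_mk, LinearMap.sub_apply,
      Module.End.mul_apply, AddSubgroupClass.coe_sub, Matrix.transpose_sub, Matrix.transpose_mul]
    noncomm_ring

/-- The representation of `sl(m)` on skew-symmetric forms, corresponding to the congruence
action. -/
def slCongruence :
    LieAlgebra.SpecialLinear.sl m K →ₗ⁅K⁆ Module.End K (skewForms K m) :=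
  (glCongruence K m).comp (LieAlgebra.SpecialLinear.sl m K).incl

end Congruence

end JK

end

/-! For generic `(Q, B)` the form `B` is nondegenerate and `det (Q - μB)` has `n` distinct roots `a
i`. A degenerate skew matrix of even size has corank at least two, so each root carries a plane. The
planes are orthogonal for both forms, hence `Q = G (diag a ⊗ J) Gᵀ` and `B = G (1 ⊗ J) Gᵀ` with `J`
the standard form on a plane (`exists_simultaneous_normalForm`).

Write `D = 1 ⊗ J` and `X = G Z Dᵀ G⁻¹`. Then `R_B X = G (Z - Zᵀ) Gᵀ` and `R_Q X = G (ZΔ - (ZΔ)ᵀ)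
Gᵀ`, where `Δ` is the diagonal matrix of the `a i`, each repeated twice, so the pencil splits along
matrix units (`isNormalForm_orbitMap`). Symmetric parts of the diagonal 2×2 blocks are killed by
both maps: `3n` zero columns. A pair `E_pq`, `E_qp` from different planes maps to one line: `4 ·
n(n-1)/2` blocks of size 1×2. What remains is the hyperplane `∑ c_i = 0` of `K^n` (the trace
condition), with its inclusion and multiplication by `a` as the two maps: one vertical block, with a
Krylov basis.

Genericity is witnessed by `pencilDiscr`, the product of `det B` and a Hankel determinant of traces
of powers of `adj(B) Q`. -/

namespace JK

/-! ### Recognising a Kronecker normal form from families of vectors -/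

section NormalForm

variable {K : Type*} [Field K] {U V : Type*} [AddCommGroup U] [Module K U] [AddCommGroup V]
  [Module K V]

/-- A normal form of a pencil from linearly independent families of the right size on which the
two maps act through the matrices of the blocks. -/
theorem isNormalForm_of_families {A B : U →ₗ[K] V} {ι : Type} [Fintype ι] [DecidableEq ι]
    [Module.Finite K U] [Module.Finite K V]
    (blocks : ι → Block K) (f : (Σ i, Fin (blocks i).cols) → U) (g : (Σ i, Fin (blocks i).rows) → V)
    (hf : LinearIndependent K f) (hg : LinearIndependent K g)
    (hU : Module.finrank K U ≤ ∑ i, (blocks i).cols)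
    (hV : Module.finrank K V ≤ ∑ i, (blocks i).rows)
    (hA : ∀ i c, A (f ⟨i, c⟩) = ∑ r, (blocks i).matA r c • g ⟨i, r⟩)
    (hB : ∀ i c, B (f ⟨i, c⟩) = ∑ r, (blocks i).matB r c • g ⟨i, r⟩) :
    IsNormalForm A B blocks := by
  -- Independence gives the opposite inequalities, so upper bounds on the dimensions are enough.
  have cU : Fintype.card (Σ i, Fin (blocks i).cols) = Module.finrank K U :=
    le_antisymm hf.fintype_card_le_finrank (by simpa using hU)
  have cV : Fintype.card (Σ i, Fin (blocks i).rows) = Module.finrank K V :=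
    le_antisymm hg.fintype_card_le_finrank (by simpa using hV)
  let bU := Module.Basis.mk hf (hf.span_eq_top_of_card_eq_finrank' cU).ge
  let bV := Module.Basis.mk hg (hg.span_eq_top_of_card_eq_finrank' cV).ge
  have key : ∀ (T : U →ₗ[K] V) (m : ∀ i, Matrix (Fin (blocks i).rows) (Fin (blocks i).cols) K),
      (∀ i c, T (f ⟨i, c⟩) = ∑ r, m i r c • g ⟨i, r⟩) →
      LinearMap.toMatrix bU bV T = Matrix.blockDiagonal' m := by
    intro T m hT
    ext ⟨i, r⟩ ⟨j, c⟩
    have hg' : ∀ s, bV.repr (g s) = Finsupp.single s 1 := fun s => by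
      rw [← bV.repr_self s, Module.Basis.mk_apply]
    rw [LinearMap.toMatrix_apply, Module.Basis.mk_apply, hT, map_sum, Matrix.blockDiagonal'_apply]
    simp only [map_smul, hg', Finsupp.coe_finsetSum, Finset.sum_apply, Finsupp.smul_single,
      smul_eq_mul, mul_one]
    split_ifs with h
    · subst h
      rw [Finset.sum_eq_single r]
      · simp
      · intro b _ hb
        rw [Finsupp.single_eq_of_ne]
        simpa using Ne.symm hb
      · simp
    · refine Finset.sum_eq_zero fun b _ => ?_
      rw [Finsupp.single_eq_of_ne]
      intro h'
      exact h (congrArg Sigma.fst h')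
  exact ⟨bU, bV, key A _ hA, key B _ hB⟩

variable (K) in
/-- Horizontal blocks of sizes `0 × 1` and `1 × 2`, indexed by `ι₁` and `ι₂`, together with one
vertical block of size `(k + 1) × k`. -/
def kroneckerBlocks (ι₁ ι₂ : Type) (k : ℕ) : ι₁ ⊕ ι₂ ⊕ Unit → Block K
  | .inl _ => .horizontal 0
  | .inr (.inl _) => .horizontal 1
  | .inr (.inr _) => .vertical k

variable {ι₁ ι₂ : Type} {k : ℕ}

/-- The vectors of the source space attached to the columns of `kroneckerBlocks`. -/
def colFamily (z : ι₁ → U) (x₀ x₁ : ι₂ → U) (u : Fin k → U) :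
    (Σ i, Fin (kroneckerBlocks K ι₁ ι₂ k i).cols) → U
  | ⟨.inl i, _⟩ => z i
  | ⟨.inr (.inl i), c⟩ => if (c : ℕ) = 0 then x₀ i else x₁ i
  | ⟨.inr (.inr _), c⟩ => u c

/-- The vectors of the target space attached to the rows of `kroneckerBlocks`. -/
def rowFamily (y : ι₂ → V) (v : Fin (k + 1) → V) :
    (Σ i, Fin (kroneckerBlocks K ι₁ ι₂ k i).rows) → V
  | ⟨.inl _, c⟩ => Fin.elim0 c
  | ⟨.inr (.inl i), _⟩ => y i
  | ⟨.inr (.inr _), c⟩ => v c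

variable [Fintype ι₁] [Fintype ι₂]

theorem sum_kroneckerBlocks_cols {M : Type*} [AddCommMonoid M]
    (F : (Σ i, Fin (kroneckerBlocks K ι₁ ι₂ k i).cols) → M) :
    ∑ s, F s = ∑ i, F ⟨.inl i, (0 : Fin 1)⟩ +
      (∑ i, (F ⟨.inr (.inl i), (0 : Fin 2)⟩ + F ⟨.inr (.inl i), (1 : Fin 2)⟩) +
        ∑ c : Fin k, F ⟨.inr (.inr ()), c⟩) := by
  rw [Fintype.sum_sigma, Fintype.sum_sum_type, Fintype.sum_sum_type]
  congr 1
  · exact Finset.sum_congr rfl fun i _ => Fin.sum_univ_one _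
  congr 1
  · exact Finset.sum_congr rfl fun i _ => Fin.sum_univ_two _
  · exact Fintype.sum_unique _

theorem sum_kroneckerBlocks_rows {M : Type*} [AddCommMonoid M]
    (F : (Σ i, Fin (kroneckerBlocks K ι₁ ι₂ k i).rows) → M) :
    ∑ s, F s = ∑ i, F ⟨.inr (.inl i), (0 : Fin 1)⟩ +
        ∑ c : Fin (k + 1), F ⟨.inr (.inr ()), c⟩ := by
  rw [Fintype.sum_sigma, Fintype.sum_sum_type, Fintype.sum_sum_type]
  rw [Finset.sum_eq_zero, zero_add]
  · congr 1
    · exact Finset.sum_congr rfl fun i _ => Fin.sum_univ_one _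
    · exact Fintype.sum_unique _
  · exact fun i _ => Fin.sum_univ_zero _

/-- A criterion for a pencil to be a direct sum of horizontal blocks of sizes `0 × 1` and `1 × 2`
and one vertical block. -/
theorem isNormalForm_kroneckerBlocks [DecidableEq ι₁] [DecidableEq ι₂]
    [Module.Finite K U] [Module.Finite K V] {A B : U →ₗ[K] V}
    {z : ι₁ → U} {x₀ x₁ : ι₂ → U} {u : Fin k → U} {y : ι₂ → V} {v : Fin (k + 1) → V}
    (hAz : ∀ i, A (z i) = 0) (hBz : ∀ i, B (z i) = 0)
    (hAx₀ : ∀ i, A (x₀ i) = 0) (hBx₀ : ∀ i, B (x₀ i) = y i)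
    (hAx₁ : ∀ i, A (x₁ i) = y i) (hBx₁ : ∀ i, B (x₁ i) = 0)
    (hAu : ∀ c, A (u c) = v c.succ) (hBu : ∀ c, B (u c) = v c.castSucc)
    (hz : LinearIndependent K z) (hyv : LinearIndependent K (Sum.elim y v))
    (hU : Module.finrank K U ≤ Fintype.card ι₁ + (2 * Fintype.card ι₂ + k))
    (hV : Module.finrank K V ≤ Fintype.card ι₂ + (k + 1)) :
    IsNormalForm A B (kroneckerBlocks K ι₁ ι₂ k) := by
  have hyv' : ∀ (a : ι₂ → K) (b : Fin (k + 1) → K), ∑ i, a i • y i + ∑ c, b c • v c = 0 →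
      (∀ i, a i = 0) ∧ ∀ c, b c = 0 := by
    intro a b hab
    have := Fintype.linearIndependent_iff.1 hyv (Sum.elim a b) (by simpa using hab)
    exact ⟨fun i => this (.inl i), fun c => this (.inr c)⟩
  refine isNormalForm_of_families _ (colFamily z x₀ x₁ u) (rowFamily y v) ?_ ?_ ?_ ?_ ?_ ?_
  · rw [Fintype.linearIndependent_iff]
    intro a ha
    rw [sum_kroneckerBlocks_cols] at ha
    set a₁ : ι₁ → K := fun i => a ⟨.inl i, (0 : Fin 1)⟩
    set b₀ : ι₂ → K := fun i => a ⟨.inr (.inl i), (0 : Fin 2)⟩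
    set b₁ : ι₂ → K := fun i => a ⟨.inr (.inl i), (1 : Fin 2)⟩
    set e : Fin k → K := fun c => a ⟨.inr (.inr ()), c⟩
    replace ha : ∑ i, a₁ i • z i + (∑ i, (b₀ i • x₀ i + b₁ i • x₁ i) + ∑ c, e c • u c) = 0 := ha
    -- `B` kills `z` and `x₁` and sends `x₀`, `u` into the independent family `y`, `v`; afterwards
    -- `A` detects `x₁`, and only a relation among the `z` is left.
    have h1 := congrArg B ha
    simp only [map_add, map_sum, map_smul, hBz, hBx₀, hBx₁, hBu, smul_zero, Finset.sum_const_zero,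
      zero_add, add_zero, map_zero] at h1
    -- The image of `u` under `B` misses the last `v`, whence the coefficient `0` there.
    have h2 := hyv' b₀ (Fin.snoc e 0) (by rw [Fin.sum_univ_castSucc]; simpa using h1)
    have he : ∀ c, e c = 0 := fun c => by simpa using h2.2 c.castSucc
    have h3 := congrArg A ha
    simp only [map_add, map_sum, map_smul, hAz, hAx₀, hAx₁, he, smul_zero, zero_smul,
      Finset.sum_const_zero, zero_add, add_zero, map_zero] at h3
    have h4 := hyv' b₁ 0 (by simpa using h3)
    simp only [h2.1, h4.1, he, zero_smul, Finset.sum_const_zero, add_zero] at ha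
    have h5 := Fintype.linearIndependent_iff.1 hz a₁ ha
    rintro ⟨i | i | i, c⟩
    · change Fin 1 at c
      rw [Subsingleton.elim c 0]
      exact h5 i
    · change Fin 2 at c
      fin_cases c
      · exact h2.1 i
      · exact h4.1 i
    · exact he c
  · rw [Fintype.linearIndependent_iff]
    intro a ha
    rw [sum_kroneckerBlocks_rows] at ha
    have h := hyv' (fun i => a ⟨.inr (.inl i), (0 : Fin 1)⟩) (fun c => a ⟨.inr (.inr ()), c⟩) ha
    rintro ⟨i | i | i, c⟩
    · exact Fin.elim0 c
    · change Fin 1 at c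
      rw [Subsingleton.elim c 0]
      exact h.1 i
    · exact h.2 c
  · simpa [kroneckerBlocks, Block.cols, mul_comm] using hU
  · simpa [kroneckerBlocks, Block.rows] using hV
  · rintro (i | i | i) c
    · exact (hAz i).trans (Fin.sum_univ_zero _).symm
    · change Fin 2 at c
      refine Eq.trans ?_ (Fin.sum_univ_one _).symm
      fin_cases c
      · simpa [kroneckerBlocks, Block.matA, superOnes, colFamily, rowFamily] using hAx₀ i
      · simpa [kroneckerBlocks, Block.matA, superOnes, colFamily, rowFamily] using hAx₁ i
    · change A (u c) = ∑ r : Fin (k + 1), subOnes K (k + 1) k r c • v r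
      change Fin k at c
      rw [hAu, Finset.sum_eq_single c.succ]
      · simp [subOnes]
      · intro b _ hb
        simp [subOnes, Fin.ext_iff] at hb ⊢
        simp [hb]
      · simp
  · rintro (i | i | i) c
    · exact (hBz i).trans (Fin.sum_univ_zero _).symm
    · change Fin 2 at c
      refine Eq.trans ?_ (Fin.sum_univ_one _).symm
      fin_cases c
      · simpa [kroneckerBlocks, Block.matB, diagOnes, colFamily, rowFamily] using hBx₀ i
      · simpa [kroneckerBlocks, Block.matB, diagOnes, colFamily, rowFamily] using hBx₁ i
    · change B (u c) = ∑ r : Fin (k + 1), diagOnes K (k + 1) k r c • v r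
      change Fin k at c
      rw [hBu, Finset.sum_eq_single c.castSucc]
      · simp [diagOnes]
      · intro b _ hb
        simp [diagOnes, Fin.ext_iff] at hb ⊢
        simp [Ne.symm hb]
      · simp

theorem filterMap_replicate {α β : Type*} (φ : α → Option β) (b : α) (m : ℕ) :
    (Multiset.replicate m b).filterMap φ = (φ b).elim 0 fun c => Multiset.replicate m c := by
  induction m with
  | zero => cases φ b <;> simp
  | succ m ih =>
    rw [Multiset.replicate_succ]
    cases hb : φ b with
    | none => rw [Multiset.filterMap_cons_none _ _ hb, ih, hb]; rfl
    | some c => rw [Multiset.filterMap_cons_some _ _ _ hb, ih, hb]; simp [Multiset.replicate_succ]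

theorem algebraicTypeOfBlocks_kroneckerBlocks (ι₁ ι₂ : Type) [Fintype ι₁] [Fintype ι₂] (k : ℕ) :
    algebraicTypeOfBlocks ((Finset.univ : Finset (ι₁ ⊕ ι₂ ⊕ Unit)).val.map
      (kroneckerBlocks K ι₁ ι₂ k)) =
    { jordan := 0
      horizontal := Multiset.replicate (Fintype.card ι₁) 1 + Multiset.replicate (Fintype.card ι₂) 2
      vertical := {k + 1} } := by
  have h : (Finset.univ : Finset (ι₁ ⊕ ι₂ ⊕ Unit)).val.map (kroneckerBlocks K ι₁ ι₂ k) =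
      Multiset.replicate (Fintype.card ι₁) (.horizontal 0) +
        (Multiset.replicate (Fintype.card ι₂) (.horizontal 1) + {.vertical k}) := by
    rw [← Finset.univ_disjSum_univ, Finset.val_disjSum, ← Finset.univ_disjSum_univ,
      Finset.val_disjSum]
    simp only [Multiset.disjSum, Multiset.map_add, Multiset.map_map]
    have e1 : kroneckerBlocks K ι₁ ι₂ k ∘ Sum.inl = fun _ => .horizontal 0 := rfl
    have e2 : kroneckerBlocks K ι₁ ι₂ k ∘ Sum.inr ∘ Sum.inl = fun _ => .horizontal 1 := rfl
    have e3 : kroneckerBlocks K ι₁ ι₂ k ∘ Sum.inr ∘ Sum.inr = fun _ => .vertical k := rfl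
    simp only [Function.comp_def] at e1 e2 e3
    simp only [Function.comp_def, e1, e2, e3, Multiset.map_const', Finset.card_val,
      Finset.card_univ]
    rfl
  have hs : ({.vertical k} : Multiset (Block K)) = Multiset.replicate 1 (.vertical k) := by simp
  rw [h, hs]
  ext1 <;> simp only [algebraicTypeOfBlocks, Multiset.filterMap_add, filterMap_replicate]
  · simp [Block.jordanData]
  · simp [Block.horizontalIndex]
  · simp [Block.verticalIndex]

end NormalForm

end JK

/-! ### The model pencil: lifts along a simultaneous normal form, and dimension bounds -/

namespace JK

section Model

open Matrix Kronecker

variable {K : Type*} [Field K]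

/-- The Lagrange weights `1 / ∏ (a i - a j)`: the sum is the coefficient of degree `n - 1` in the
interpolation of `X ^ c`, which is zero for `c < n - 1`. These relations make the Krylov vectors of
the vertical block traceless. -/
theorem exists_weights {n : ℕ} {a : Fin n → K} (ha : Function.Injective a) :
    ∃ w : Fin n → K, (∀ i, w i ≠ 0) ∧ ∀ c, c + 1 < n → ∑ i, a i ^ c * w i = 0 := by
  refine ⟨fun i => (∏ j ∈ Finset.univ.erase i, (a i - a j))⁻¹, fun i => ?_, fun c hc => ?_⟩
  · refine inv_ne_zero (Finset.prod_ne_zero_iff.2 fun j hj => sub_ne_zero.2 fun h => ?_)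
    exact (Finset.mem_erase.1 hj).1 (ha h).symm
  · have h := Lagrange.coeff_eq_sum (s := Finset.univ) (v := a) ha.injOn (P := Polynomial.X ^ c)
      (by rw [Polynomial.degree_X_pow]; simp; omega)
    rw [Polynomial.coeff_X_pow, if_neg (by simp; omega)] at h
    simpa [div_eq_mul_inv] using h.symm

theorem eq_zero_of_sum_pow_eq_zero {n : ℕ} {a : Fin n → K} (ha : Function.Injective a)
    {b : Fin n → K} (h : ∀ i, ∑ c, b c * a i ^ (c : ℕ) = 0) : ∀ c, b c = 0 := by
  refine congrFun (Matrix.eq_zero_of_mulVec_eq_zero (Matrix.det_vandermonde_ne_zero_iff.2 ha) ?_)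
  ext i
  simpa [Matrix.mulVec, dotProduct, Matrix.vandermonde_apply, mul_comm] using h i

variable (K) in
/-- The standard skew-symmetric form on a plane. -/
def planeForm : Matrix (Fin 2) (Fin 2) K := !![0, 1; -1, 0]

variable (K) in
/-- The standard symplectic form on a sum of `n` planes. -/
abbrev sumForm (n : ℕ) : Matrix (Fin n × Fin 2) (Fin n × Fin 2) K :=
  (1 : Matrix (Fin n) (Fin n) K) ⊗ₖ planeForm K

theorem planeForm_transpose : (planeForm K)ᵀ = -planeForm K := by
  ext i j; fin_cases i <;> fin_cases j <;> simp [planeForm]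

theorem planeForm_mul_transpose : planeForm K * (planeForm K)ᵀ = 1 := by
  ext i j; fin_cases i <;> fin_cases j <;> simp [planeForm, Matrix.mul_apply]

theorem planeForm_transpose_mul : (planeForm K)ᵀ * planeForm K = 1 :=
  mul_eq_one_comm.1 planeForm_mul_transpose

theorem kronecker_planeForm_transpose {n : ℕ} (a : Fin n → K) :
    (diagonal a ⊗ₖ planeForm K)ᵀ = -(diagonal a ⊗ₖ planeForm K) := by
  rw [← Matrix.kroneckerMap_transpose, planeForm_transpose, Matrix.diagonal_transpose]
  ext; simp

/-- Since `JᵀJ = 1`, the factor `Dᵀ` in `slLift` turns the action on both forms into right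
multiplication by a diagonal matrix. -/
theorem sumForm_transpose_mul {n : ℕ} (a : Fin n → K) :
    (sumForm K n)ᵀ * (diagonal a ⊗ₖ planeForm K) = diagonal fun p => a p.1 := by
  rw [← Matrix.kroneckerMap_transpose, ← Matrix.mul_kronecker_mul, planeForm_transpose_mul,
    Matrix.transpose_one, one_mul, ← Matrix.diagonal_one, Matrix.diagonal_kronecker_diagonal]
  simp

theorem sumForm_apply_comm {n : ℕ} (p q : Fin n × Fin 2) :
    sumForm K n q p = -sumForm K n p q := by
  have := congrFun (congrFun (kronecker_planeForm_transpose (K := K) (n := n) fun _ => 1) p) q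
  simpa using this

variable {n : ℕ} {m : Type*} [Fintype m] [DecidableEq m]

/-- The skew-symmetric matrix `G (N - Nᵀ) Gᵀ`. -/
def skewLift (G : Matrix m (Fin n × Fin 2) K) :
    Matrix (Fin n × Fin 2) (Fin n × Fin 2) K →ₗ[K] skewForms K m where
  toFun N := ⟨G * (N - Nᵀ) * Gᵀ, by
    change (G * (N - Nᵀ) * Gᵀ)ᵀ = -(G * (N - Nᵀ) * Gᵀ)
    rw [← Matrix.neg_mul, ← Matrix.mul_neg, neg_sub]
    simp only [Matrix.transpose_mul, Matrix.transpose_sub, Matrix.transpose_transpose,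
      Matrix.mul_assoc]⟩
  map_add' M N := by
    apply Subtype.ext
    simp only [Submodule.coe_add, Matrix.transpose_add, Matrix.mul_sub, Matrix.sub_mul,
      Matrix.mul_add, Matrix.add_mul]
    abel
  map_smul' c N := by
    apply Subtype.ext
    simp [← smul_sub]

theorem skewLift_transpose (G : Matrix m (Fin n × Fin 2) K)
    (N : Matrix (Fin n × Fin 2) (Fin n × Fin 2) K) : skewLift G Nᵀ = -skewLift G N := by
  apply Subtype.ext
  change G * (Nᵀ - Nᵀᵀ) * Gᵀ = -(G * (N - Nᵀ) * Gᵀ)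
  rw [Matrix.transpose_transpose, ← Matrix.neg_mul, ← Matrix.mul_neg, neg_sub]

theorem skewLift_single_comm (G : Matrix m (Fin n × Fin 2) K) (p q : Fin n × Fin 2) :
    skewLift G (single q p 1) = -skewLift G (single p q 1) := by
  rw [← skewLift_transpose, Matrix.transpose_single]

/-- Multiplying by `H` and `Hᵀ` recovers `N - Nᵀ`, so the kernel of `skewLift` consists of symmetric
matrices. -/
theorem apply_comm_of_skewLift_eq_zero {G : Matrix m (Fin n × Fin 2) K}
    {H : Matrix (Fin n × Fin 2) m K} (hHG : H * G = 1)
    {N : Matrix (Fin n × Fin 2) (Fin n × Fin 2) K} (h : skewLift G N = 0) (p q) :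
    N p q = N q p := by
  have h1 : G * (N - Nᵀ) * Gᵀ = 0 := congrArg Subtype.val h
  have h2 : H * (G * (N - Nᵀ) * Gᵀ) * Hᵀ = N - Nᵀ := by
    rw [show H * (G * (N - Nᵀ) * Gᵀ) * Hᵀ = (H * G) * (N - Nᵀ) * (H * G)ᵀ by
      simp only [Matrix.transpose_mul, Matrix.mul_assoc], hHG]
    simp
  rw [h1] at h2
  have := congrFun (congrFun h2 p) q
  simp only [Matrix.mul_zero, Matrix.zero_mul, Matrix.zero_apply, Matrix.sub_apply,
    Matrix.transpose_apply] at this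
  exact sub_eq_zero.1 this.symm

/-- The element `G Z Dᵀ H` of the special linear Lie algebra, where `D` is the standard symplectic
form. -/
def slLift (G : Matrix m (Fin n × Fin 2) K) (H : Matrix (Fin n × Fin 2) m K) (hHG : H * G = 1)
    (Z : Matrix (Fin n × Fin 2) (Fin n × Fin 2) K) (hZ : (Z * (sumForm K n)ᵀ).trace = 0) :
    LieAlgebra.SpecialLinear.sl m K :=
  ⟨G * Z * (sumForm K n)ᵀ * H, by
    change (G * Z * (sumForm K n)ᵀ * H).trace = 0
    rw [Matrix.trace_mul_comm, Matrix.mul_assoc G, ← Matrix.mul_assoc H, hHG, Matrix.one_mul, hZ]⟩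

theorem orbitMap_slLift {G : Matrix m (Fin n × Fin 2) K} {H : Matrix (Fin n × Fin 2) m K}
    (hHG : H * G = 1) {Z : Matrix (Fin n × Fin 2) (Fin n × Fin 2) K}
    (hZ : (Z * (sumForm K n)ᵀ).trace = 0) {S : skewForms K m} {a : Fin n → K}
    (hS : (S : Matrix m m K) = G * (diagonal a ⊗ₖ planeForm K) * Gᵀ) :
    orbitMap (slCongruence K m) S (slLift G H hHG Z hZ) =
      skewLift G (Z * diagonal fun p => a p.1) := by
  apply Subtype.ext
  have h1 : (G * Z * (sumForm K n)ᵀ * H) * (S : Matrix m m K) =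
      G * (Z * diagonal fun p => a p.1) * Gᵀ := by
    rw [hS, ← sumForm_transpose_mul]
    calc _ = G * Z * (sumForm K n)ᵀ * (H * G) * (diagonal a ⊗ₖ planeForm K) * Gᵀ := by
          simp only [Matrix.mul_assoc]
      _ = _ := by rw [hHG]; simp only [Matrix.mul_assoc, Matrix.one_mul]
  have h2 : (S : Matrix m m K)ᵀ = -(S : Matrix m m K) := S.2
  -- For skew `S`, the second term of the action is minus the transpose of the first.
  have h3 : (S : Matrix m m K) * (G * Z * (sumForm K n)ᵀ * H)ᵀ =
      -(G * (Z * diagonal fun p => a p.1) * Gᵀ)ᵀ := by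
    rw [← h1, Matrix.transpose_mul _ (S : Matrix m m K), h2, Matrix.neg_mul, neg_neg]
  change (G * Z * (sumForm K n)ᵀ * H) * (S : Matrix m m K) +
    (S : Matrix m m K) * (G * Z * (sumForm K n)ᵀ * H)ᵀ = _
  rw [h1, h3]
  simp only [skewLift, LinearMap.coe_mk, AddHom.coe_mk, Matrix.transpose_mul,
    Matrix.transpose_transpose, Matrix.mul_sub, Matrix.sub_mul, Matrix.mul_assoc]
  rw [sub_eq_add_neg]

/-- `Z` is recovered from its lift `X` as `H X G D`. -/
theorem linearIndependent_slLift {ι : Type*} [Fintype ι]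
    {G : Matrix m (Fin n × Fin 2) K} {H : Matrix (Fin n × Fin 2) m K}
    (hHG : H * G = 1) {Z : ι → Matrix (Fin n × Fin 2) (Fin n × Fin 2) K}
    (hZ : ∀ i, (Z i * (sumForm K n)ᵀ).trace = 0) (hli : LinearIndependent K Z) :
    LinearIndependent K fun i => slLift G H hHG (Z i) (hZ i) := by
  rw [Fintype.linearIndependent_iff] at hli ⊢
  intro g hg
  apply hli g
  have h1 := congrArg (LieAlgebra.SpecialLinear.sl m K).toSubmodule.subtype hg
  rw [map_sum] at h1
  replace h1 : ∑ i, g i • (G * Z i * (sumForm K n)ᵀ * H) = 0 := h1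
  have h2 : (sumForm K n)ᵀ * sumForm K n = 1 := by
    simpa using sumForm_transpose_mul (K := K) (n := n) fun _ => 1
  have h3 : ∀ i, H * (G * Z i * (sumForm K n)ᵀ * H) * (G * sumForm K n) = Z i := fun i => by
    calc _ = (H * G) * Z i * ((sumForm K n)ᵀ * ((H * G) * sumForm K n)) := by
          simp only [Matrix.mul_assoc]
      _ = _ := by rw [hHG, Matrix.one_mul, Matrix.one_mul, h2, Matrix.mul_one]
  have h4 := congrArg (fun X => H * X * (G * sumForm K n)) h1
  simp only [Matrix.mul_sum, Matrix.sum_mul, Matrix.mul_smul, Matrix.smul_mul, h3] at h4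
  simpa using h4

theorem finrank_sl_le [Nonempty m] :
    Module.finrank K (LieAlgebra.SpecialLinear.sl m K) ≤ Fintype.card m * Fintype.card m - 1 := by
  have h : (LieAlgebra.SpecialLinear.sl m K).toSubmodule < ⊤ := by
    rw [lt_top_iff_ne_top]
    intro h
    obtain ⟨i⟩ := ‹Nonempty m›
    have h1 : single i i (1 : K) ∈ (LieAlgebra.SpecialLinear.sl m K).toSubmodule := h ▸ trivial
    have h2 : (single i i (1 : K)).trace = 0 := h1
    simp at h2
  have := Submodule.finrank_lt h.ne
  rw [Module.finrank_matrix, Module.finrank_self, mul_one] at this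
  exact Nat.le_sub_one_of_lt this

/-- The entries above the diagonal blocks of a skew-symmetric matrix with blocks of size two. -/
abbrev UpperIndex (n : ℕ) : Type :=
  {p : Fin n × Fin n // p.1 < p.2} × Fin 2 × Fin 2

/-- The row of an entry above the diagonal blocks. -/
def UpperIndex.row (t : UpperIndex n) : Fin n × Fin 2 := (t.1.1.1, t.2.1)

/-- The column of an entry above the diagonal blocks. -/
def UpperIndex.col (t : UpperIndex n) : Fin n × Fin 2 := (t.1.1.2, t.2.2)

theorem card_upperIndex (n : ℕ) : Fintype.card (UpperIndex n) = 2 * n * (n - 1) := by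
  have h : Fintype.card {p : Fin n × Fin n // p.1 < p.2} * 2 = n * (n - 1) := by
    let e : {p : Fin n × Fin n // p.1 < p.2} ≃ Σ j : Fin n, Fin (j : ℕ) :=
      { toFun := fun p => ⟨p.1.2, p.1.1, p.2⟩
        invFun := fun s => ⟨(⟨s.2, s.2.2.trans s.1.2⟩, s.1), s.2.2⟩
        left_inv := fun _ => rfl
        right_inv := fun _ => rfl }
    rw [Fintype.card_congr e, Fintype.card_sigma]
    simp only [Fintype.card_fin]
    rw [Fin.sum_univ_eq_sum_range fun i => i, Finset.sum_range_id_mul_two]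
  rw [Fintype.card_prod, Fintype.card_prod, Fintype.card_fin]
  linarith

/-- In the coordinates given by `H`, a skew matrix is determined by its entries above the diagonal
blocks and one entry per diagonal block; its diagonal vanishes because the characteristic is not 2.
-/
theorem finrank_skewForms_le [CharZero K] {G : Matrix m (Fin n × Fin 2) K}
    {H : Matrix (Fin n × Fin 2) m K} (hGH : G * H = 1) :
    Module.finrank K (skewForms K m) ≤ Fintype.card (UpperIndex n) + n := by
  let Φ : skewForms K m →ₗ[K] (UpperIndex n ⊕ Fin n → K) :=
    { toFun := fun S => Sum.elim (fun t => (H * (S : Matrix m m K) * Hᵀ) t.row t.col)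
        (fun i => (H * (S : Matrix m m K) * Hᵀ) (i, 0) (i, 1))
      map_add' := fun S T => by
        ext (t | i) <;> simp [Matrix.mul_add, Matrix.add_mul]
      map_smul' := fun c S => by
        ext (t | i) <;> simp }
  have hΦ : Function.Injective Φ := by
    rw [← LinearMap.ker_eq_bot, LinearMap.ker_eq_bot']
    intro S hS
    set N := H * (S : Matrix m m K) * Hᵀ with hN
    have h1 : ∀ t : UpperIndex n, N t.row t.col = 0 := fun t => congrFun hS (.inl t)
    have h2 : ∀ i, N (i, 0) (i, 1) = 0 := fun i => congrFun hS (.inr i)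
    have h3 : ∀ p q, N p q = -N q p := by
      intro p q
      have hST : (S : Matrix m m K)ᵀ = -(S : Matrix m m K) := S.2
      have : Nᵀ = -N := by
        rw [hN, Matrix.transpose_mul, Matrix.transpose_mul, hST]
        simp [Matrix.mul_assoc]
      exact congrFun (congrFun this q) p
    have h4 : N = 0 := by
      ext ⟨i, α⟩ ⟨j, β⟩
      rcases lt_trichotomy i j with h | h | h
      · exact h1 (⟨(i, j), h⟩, α, β)
      · subst h
        have hd : ∀ p, N p p = 0 := fun p => self_eq_neg.1 (h3 p p)
        fin_cases α <;> fin_cases β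
        · exact hd _
        · exact h2 i
        · exact (h3 _ _).trans (by simpa using h2 i)
        · exact hd _
      · exact (h3 _ _).trans (neg_eq_zero.2 (h1 (⟨(j, i), h⟩, β, α)))
    apply Subtype.ext
    calc (S : Matrix m m K) = (G * H) * (S : Matrix m m K) * (G * H)ᵀ := by simp [hGH]
      _ = G * N * Gᵀ := by simp only [hN, Matrix.transpose_mul, Matrix.mul_assoc]
      _ = 0 := by simp [h4]
  simpa using LinearMap.finrank_le_finrank_of_injective hΦ

end Model

end JK

/-! ### The normal form of the model pencil -/

namespace JK

section ModelNormalForm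

open Matrix Kronecker

variable {K : Type*} [Field K] {n : ℕ} {m : Type*} [Fintype m] [DecidableEq m]

/-- The matrices spanning the symmetric parts of the diagonal blocks. -/
def diagonalBlockSymm (K : Type*) [Field K] (t : Fin n × Fin 3) :
    Matrix (Fin n × Fin 2) (Fin n × Fin 2) K :=
  single (t.1, ![0, 1, 0] t.2) (t.1, ![0, 1, 1] t.2) 1 +
    single (t.1, ![0, 1, 1] t.2) (t.1, ![0, 1, 0] t.2) 1

/-- For `s = 0, 1` the two matrix units coincide and the entry is `2`; it is nonzero by `CharZero`.
-/
theorem linearIndependent_diagonalBlockSymm [CharZero K] :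
    LinearIndependent K (diagonalBlockSymm K : Fin n × Fin 3 → _) := by
  rw [Fintype.linearIndependent_iff]
  intro g hg
  have h : ∀ p q, ∑ i, ∑ s, g (i, s) * diagonalBlockSymm K (i, s) p q = 0 := by
    intro p q
    have := congrFun (congrFun hg p) q
    rw [Fintype.sum_prod_type] at this
    simpa [Matrix.sum_apply] using this
  rintro ⟨i, s⟩
  have h0 := h (i, 0) (i, 0)
  have h1 := h (i, 1) (i, 1)
  have h2 := h (i, 0) (i, 1)
  simp [diagonalBlockSymm, Fin.sum_univ_three, Matrix.single_apply]
    at h0 h1 h2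
  fin_cases s
  · simpa [← two_mul] using h0
  · simpa [← two_mul] using h1
  · exact h2

theorem trace_single_mul_sumForm_transpose (p q : Fin n × Fin 2) :
    (single p q (1 : K) * (sumForm K n)ᵀ).trace = sumForm K n p q := by
  rw [Matrix.trace_single_mul]
  simp

theorem skewLift_single_mul_diagonal (G : Matrix m (Fin n × Fin 2) K) (a : Fin n → K)
    (p q : Fin n × Fin 2) :
    skewLift G (single p q 1 * diagonal fun r => a r.1) = a q.1 • skewLift G (single p q 1) := by
  rw [← map_smul]
  congr 1
  ext r s
  simp only [Matrix.mul_diagonal, Matrix.smul_apply, Matrix.single_apply, smul_eq_mul]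
  split_ifs with h
  · rw [h.2]; ring
  · simp

/-- A relation produces a symmetric `N` whose entries all lie strictly above the diagonal, so `N =
0`. The coefficients at the matrix units of the diagonal blocks are values of a polynomial of degree
below `n` times `w i`, and Vandermonde finishes. -/
theorem linearIndependent_skewLift {a w : Fin n → K} (ha : Function.Injective a)
    (hw : ∀ i, w i ≠ 0) {G : Matrix m (Fin n × Fin 2) K} {H : Matrix (Fin n × Fin 2) m K}
    (hHG : H * G = 1) :
    LinearIndependent K (Sum.elim (fun t : UpperIndex n => skewLift G (single t.row t.col 1))
      fun c : Fin n => ∑ i, (a i ^ (c : ℕ) * w i) • skewLift G (single (i, 0) (i, 1) 1)) := by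
  rw [Fintype.linearIndependent_iff]
  intro g hg
  rw [Fintype.sum_sum_type] at hg
  set f : UpperIndex n → K := fun t => g (.inl t) with hf
  set d : Fin n → K := fun i => ∑ c, g (.inr c) * (a i ^ (c : ℕ) * w i) with hd
  set N : Matrix (Fin n × Fin 2) (Fin n × Fin 2) K :=
    ∑ t, f t • single (UpperIndex.row t) t.col 1 + ∑ i, d i • single (i, 0) (i, 1) 1 with hN
  have hN0 : skewLift G N = 0 := by
    rw [← hg, hN]
    simp only [map_add, map_sum, map_smul, Sum.elim_inl, Sum.elim_inr, Finset.smul_sum, hd,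
      Finset.sum_smul, smul_smul]
    congr 1
    exact Finset.sum_comm
  have hNpq : ∀ p q, N p q = ∑ t : UpperIndex n, f t * (if t.row = p ∧ t.col = q then 1 else 0) +
      ∑ i, d i * (if (i, 0) = p ∧ (i, 1) = q then 1 else 0) := by
    intro p q
    simp [hN, Matrix.sum_apply, Matrix.single_apply]
  have hsymm := apply_comm_of_skewLift_eq_zero hHG hN0
  have h1 : ∀ t : UpperIndex n, f t = 0 := by
    rintro ⟨⟨⟨i, j⟩, hij⟩, α, β⟩
    have hij' : i < j := hij
    have h := hsymm (i, α) (j, β)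
    rw [hNpq, hNpq, Finset.sum_eq_single ⟨⟨⟨i, j⟩, hij⟩, α, β⟩, Finset.sum_eq_zero,
      Finset.sum_eq_zero, Finset.sum_eq_zero] at h
    · simpa [UpperIndex.row, UpperIndex.col] using h
    · intro l _
      rw [if_neg, mul_zero]
      simp only [Prod.mk.injEq]
      rintro ⟨⟨rfl, -⟩, rfl, -⟩
      exact hij'.false
    · rintro ⟨⟨⟨i', j'⟩, h'⟩, α', β'⟩ _
      rw [if_neg, mul_zero]
      simp only [UpperIndex.row, UpperIndex.col, Prod.mk.injEq]
      rintro ⟨⟨rfl, -⟩, rfl, -⟩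
      exact hij'.asymm h'
    · intro l _
      rw [if_neg, mul_zero]
      simp only [Prod.mk.injEq]
      rintro ⟨⟨rfl, -⟩, rfl, -⟩
      exact hij'.false
    · rintro ⟨⟨⟨i', j'⟩, h'⟩, α', β'⟩ _ hne
      rw [if_neg, mul_zero]
      simp only [UpperIndex.row, UpperIndex.col, Prod.mk.injEq]
      rintro ⟨⟨rfl, rfl⟩, rfl, rfl⟩
      exact hne rfl
    · simp
  have h2 : ∀ i, d i = 0 := by
    intro i
    have h := hsymm (i, 0) (i, 1)
    simpa [hNpq, h1, Finset.sum_ite_eq] using h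
  have h3 : ∀ c, g (.inr c) = 0 := by
    refine eq_zero_of_sum_pow_eq_zero ha fun i => ?_
    have := h2 i
    simp only [hd, ← mul_assoc, ← Finset.sum_mul] at this
    exact (mul_eq_zero.1 this).resolve_right (hw i)
  rintro (t | c)
  · exact h1 t
  · exact h3 c

/-- The normal form of the pencil attached to a pair of skew-symmetric forms that are
simultaneously sums of `k + 1` planes, with distinct ratios. -/
theorem isNormalForm_orbitMap [CharZero K] {k : ℕ} {G : Matrix m (Fin (k + 1) × Fin 2) K}
    {H : Matrix (Fin (k + 1) × Fin 2) m K} (hHG : H * G = 1) (hGH : G * H = 1)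
    (hm : Fintype.card m = 2 * (k + 1)) {a : Fin (k + 1) → K} (ha : Function.Injective a)
    {Q B : skewForms K m} (hQ : (Q : Matrix m m K) = G * (diagonal a ⊗ₖ planeForm K) * Gᵀ)
    (hB : (B : Matrix m m K) = G * sumForm K (k + 1) * Gᵀ) :
    IsNormalForm (orbitMap (slCongruence K m) Q) (orbitMap (slCongruence K m) B)
      (kroneckerBlocks K (Fin (k + 1) × Fin 3) (UpperIndex (k + 1)) k) := by
  obtain ⟨w, hw, hw'⟩ := exists_weights ha
  have hB' : (B : Matrix m m K) = G * (diagonal (fun _ : Fin (k + 1) => (1 : K)) ⊗ₖ planeForm K) * Gᵀ := by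
    rw [Matrix.diagonal_one]; exact hB
  have hQl := fun Z hZ => orbitMap_slLift hHG (Z := Z) hZ hQ
  have hBl : ∀ Z hZ, orbitMap (slCongruence K m) B (slLift G H hHG Z hZ) = skewLift G Z :=
    fun Z hZ => by
      rw [orbitMap_slLift hHG hZ hB', Matrix.diagonal_one, Matrix.mul_one]
  have hne : ∀ t : UpperIndex (k + 1), a t.row.1 - a t.col.1 ≠ 0 := fun t =>
    sub_ne_zero.2 fun h => t.1.2.ne (ha h)
  have hzero : ∀ t : UpperIndex (k + 1), sumForm K (k + 1) t.row t.col = 0 := fun t => by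
    have : t.row.1 ≠ t.col.1 := t.1.2.ne
    simp [this]
  have hzero' : ∀ t : UpperIndex (k + 1), sumForm K (k + 1) t.col t.row = 0 := fun t => by
    rw [sumForm_apply_comm, hzero, neg_zero]
  refine isNormalForm_kroneckerBlocks
    (z := fun t => slLift G H hHG (diagonalBlockSymm K t) ?_)
    -- On the span of `E_pq` and `E_qp`, the kernel of `R_Q` is spanned by `a_p E_pq + a_q E_qp` and
    -- that of `R_B` by `E_pq + E_qp`; the scalars normalise the other image to `y`.
    (x₀ := fun t : UpperIndex (k + 1) => slLift G H hHG ((a t.row.1 - a t.col.1)⁻¹ •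
      (a t.row.1 • single t.row t.col 1 + a t.col.1 • single t.col t.row 1)) ?_)
    (x₁ := fun t : UpperIndex (k + 1) => slLift G H hHG (-(a t.row.1 - a t.col.1)⁻¹ •
      (single t.row t.col 1 + single t.col t.row 1)) ?_)
    -- Multiplication by `a` shifts the exponent, so `R_B` sends `u c` to `v c` and `R_Q` sends it
    -- to the next `v`. Only `k` exponents satisfy the trace condition, against `k + 1` vectors `v`.
    (u := fun c => slLift G H hHG (∑ i, (a i ^ (c : ℕ) * w i) • single (i, 0) (i, 1) 1) ?_)
    (y := fun t : UpperIndex (k + 1) => skewLift G (single t.row t.col 1))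
    (v := fun c => ∑ i, (a i ^ (c : ℕ) * w i) • skewLift G (single (i, 0) (i, 1) 1))
    ?_ ?_ ?_ ?_ ?_ ?_ ?_ ?_ ?_ ?_ ?_ ?_
  · rw [diagonalBlockSymm, Matrix.add_mul, Matrix.trace_add, trace_single_mul_sumForm_transpose,
      trace_single_mul_sumForm_transpose, sumForm_apply_comm]
    ring
  · simp only [Matrix.add_mul, Matrix.smul_mul, Matrix.trace_add, Matrix.trace_smul,
      trace_single_mul_sumForm_transpose, hzero, hzero', smul_zero, add_zero]
  · simp only [Matrix.add_mul, Matrix.smul_mul, Matrix.trace_add, Matrix.trace_smul,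
      trace_single_mul_sumForm_transpose, hzero, hzero', smul_zero, add_zero]
  · simp only [Matrix.sum_mul, Matrix.smul_mul, Matrix.trace_sum, Matrix.trace_smul,
      trace_single_mul_sumForm_transpose]
    simpa [planeForm] using hw' c (by omega)
  · intro t
    simp only [hQl, diagonalBlockSymm, Matrix.add_mul, map_add, skewLift_single_mul_diagonal]
    rw [skewLift_single_comm, smul_neg, neg_add_cancel]
  · intro t
    simp only [hBl, diagonalBlockSymm, map_add]
    rw [skewLift_single_comm, neg_add_cancel]
  · intro t
    simp only [hQl, Matrix.add_mul, Matrix.smul_mul, map_add, map_smul,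
      skewLift_single_mul_diagonal, skewLift_single_comm G t.row t.col, smul_smul, smul_neg,
      mul_comm (a t.col.1), add_neg_cancel, smul_zero]
  · intro t
    simp only [hBl, map_add, map_smul, skewLift_single_comm G t.row t.col]
    match_scalars
    linear_combination inv_mul_cancel₀ (hne t)
  · intro t
    simp only [hQl, Matrix.add_mul, Matrix.smul_mul, map_add, map_smul,
      skewLift_single_mul_diagonal, skewLift_single_comm G t.row t.col]
    match_scalars
    linear_combination inv_mul_cancel₀ (hne t)
  · intro t
    simp only [hBl, map_add, map_smul, skewLift_single_comm G t.row t.col, add_neg_cancel,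
      smul_zero]
  · intro c
    simp only [hQl, Matrix.sum_mul, Matrix.smul_mul, map_sum, map_smul,
      skewLift_single_mul_diagonal, smul_smul, Fin.val_succ, pow_succ, mul_right_comm]
  · intro c
    simp only [hBl, map_sum, map_smul, Fin.val_castSucc]
  · exact linearIndependent_slLift hHG _ linearIndependent_diagonalBlockSymm
  · exact linearIndependent_skewLift ha hw hHG
  · have : Nonempty m := Fintype.card_pos_iff.1 (by omega)
    -- The count is `4(k+1)² - 1 = 3(k+1) + 4k(k+1) + k`.
    refine finrank_sl_le.trans ?_
    rw [hm, card_upperIndex]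
    simp only [Fintype.card_prod, Fintype.card_fin, Nat.add_sub_cancel]
    rw [Nat.sub_le_iff_le_add]
    nlinarith
  · exact finrank_skewForms_le hGH

end ModelNormalForm

end JK

/-! ### Simultaneous reduction of two skew forms -/

namespace JK

section SimultaneousNormalForm

open Matrix Kronecker

variable {K : Type*} [Field K] {n : ℕ} {m : Type*} [Fintype m] [DecidableEq m]

theorem det_eq_zero_of_transpose_eq_neg [CharZero K] {S : Matrix m m K} (hS : Sᵀ = -S)
    (hm : Odd (Fintype.card m)) : S.det = 0 := by
  have h := Matrix.det_transpose S
  rw [hS, Matrix.det_neg, hm.neg_one_pow, neg_one_mul] at h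
  exact self_eq_neg.1 h.symm

theorem dotProduct_mulVec_comm {S : Matrix m m K} (hS : Sᵀ = -S) (x y : m → K) :
    x ⬝ᵥ S *ᵥ y = -(y ⬝ᵥ S *ᵥ x) := by
  rw [Matrix.dotProduct_mulVec, ← Matrix.mulVec_transpose, hS, Matrix.neg_mulVec, neg_dotProduct,
    dotProduct_comm]

/-- A degenerate skew-symmetric matrix of even size has corank at least two. -/
theorem exists_linearIndependent_mulVec_eq_zero [CharZero K] {S : Matrix m m K} (hS : Sᵀ = -S)
    (hm : Even (Fintype.card m)) (hdet : S.det = 0) :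
    ∃ f : Fin 2 → m → K, LinearIndependent K f ∧ ∀ α, S *ᵥ f α = 0 := by
  obtain ⟨w, hw, hSw⟩ := Matrix.exists_mulVec_eq_zero_iff.2 hdet
  obtain ⟨k, hk⟩ := Function.ne_iff.1 hw
  have hk : w k ≠ 0 := hk
  -- Deleting row and column `k` leaves a skew matrix of odd size, hence singular. Its null vector,
  -- extended by `0` at `k`, is independent of `w` because `w k ≠ 0`.
  let S' : Matrix {i // i ≠ k} {i // i ≠ k} K := S.submatrix Subtype.val Subtype.val
  have hS' : S'ᵀ = -S' := by
    rw [Matrix.transpose_submatrix, hS]; rfl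
  have hodd : Odd (Fintype.card {i // i ≠ k}) := by
    have : 0 < Fintype.card m := Fintype.card_pos_iff.2 ⟨k⟩
    rw [Fintype.card_subtype_compl, Fintype.card_subtype_eq]
    exact Nat.Even.sub_odd this hm odd_one
  obtain ⟨x, hx, hSx⟩ := Matrix.exists_mulVec_eq_zero_iff.2 (det_eq_zero_of_transpose_eq_neg hS' hodd)
  let y : m → K := fun i => if h : i ≠ k then x ⟨i, h⟩ else 0
  have hyk : y k = 0 := by simp [y]
  have hy : ∀ i : {i // i ≠ k}, y i = x i := fun i => by simp [y, i.2]
  have hSy : ∀ i, i ≠ k → (S *ᵥ y) i = 0 := by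
    intro i hi
    have h := congrFun hSx ⟨i, hi⟩
    simp only [Matrix.mulVec, dotProduct, Pi.zero_apply] at h ⊢
    rw [Fintype.sum_eq_add_sum_subtype_ne _ k, hyk, mul_zero, zero_add, ← h]
    exact Finset.sum_congr rfl fun j _ => by rw [hy]; rfl
  -- `S y` is supported at `k`, and `w ⬝ S y = -(y ⬝ S w) = 0` with `w k ≠ 0`.
  have hSyk : (S *ᵥ y) k = 0 := by
    have h := dotProduct_mulVec_comm hS w y
    rw [hSw, dotProduct_zero, neg_zero, dotProduct, Finset.sum_eq_single k] at h
    · exact (mul_eq_zero.1 h).resolve_left hk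
    · intro i _ hi
      rw [hSy i hi, mul_zero]
    · simp
  refine ⟨![w, y], LinearIndependent.pair_iff.2 fun s t hst => ?_, fun α => ?_⟩
  · have hs : s = 0 := by simpa [hyk, hk] using congrFun hst k
    refine ⟨hs, ?_⟩
    obtain ⟨i, hi⟩ := Function.ne_iff.1 hx
    have hi : x i ≠ 0 := hi
    simpa [hs, hy, hi] using congrFun hst i
  · fin_cases α
    · exact hSw
    · ext i
      by_cases hi : i = k
      · subst hi; exact hSyk
      · exact hSy i hi

/-- Simultaneous normal form of two skew-symmetric forms with the largest possible number of
characteristic ratios. -/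
theorem exists_simultaneous_normalForm [CharZero K] (hm : Fintype.card m = 2 * n) {Q B : Matrix m m K}
    (hQ : Qᵀ = -Q) (hB : Bᵀ = -B) (hdet : B.det ≠ 0) {a : Fin n → K} (ha : Function.Injective a)
    (hroot : ∀ i, (Q - a i • B).det = 0) :
    ∃ (G : Matrix m (Fin n × Fin 2) K) (H : Matrix (Fin n × Fin 2) m K), H * G = 1 ∧ G * H = 1 ∧
      Q = G * (diagonal a ⊗ₖ planeForm K) * Gᵀ ∧ B = G * sumForm K n * Gᵀ := by
  have hev : ∀ i, ∃ f : Fin 2 → m → K, LinearIndependent K f ∧ ∀ α, (Q - a i • B) *ᵥ f α = 0 :=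
    fun i => exists_linearIndependent_mulVec_eq_zero
      (by rw [Matrix.transpose_sub, Matrix.transpose_smul, hQ, hB, smul_neg]; abel)
      (by rw [hm]; exact even_two_mul n) (hroot i)
  choose f hfli hf using hev
  have hQf : ∀ i α, Q *ᵥ f i α = a i • B *ᵥ f i α := fun i α => by
    have := hf i α
    rwa [Matrix.sub_mulVec, Matrix.smul_mulVec, sub_eq_zero] at this
  -- Moving `Q` across the pairing gives `(a j - a i) (f_i ⬝ B f_j) = 0`.
  have horth : ∀ i j α β, i ≠ j → f i α ⬝ᵥ B *ᵥ f j β = 0 := by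
    intro i j α β hij
    have h1 := dotProduct_mulVec_comm hQ (f i α) (f j β)
    rw [hQf, hQf, dotProduct_smul, dotProduct_smul, dotProduct_mulVec_comm hB (f j β), smul_neg,
      neg_neg, ← sub_eq_zero, ← sub_smul, smul_eq_mul] at h1
    exact (mul_eq_zero.1 h1).resolve_left (sub_ne_zero.2 fun h => hij (ha h).symm)
  have hBu : IsUnit B.det := isUnit_iff_ne_zero.2 hdet
  have hli : LinearIndependent K fun p : Fin n × Fin 2 => f p.1 p.2 := by
    rw [Fintype.linearIndependent_iff]
    intro g hg
    rw [Fintype.sum_prod_type] at hg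
    have hind := (Module.End.eigenspaces_iSupIndep (Matrix.toLin' (B⁻¹ * Q))).comp ha
    rw [iSupIndep_iff_finsetSum_eq_zero_imp_eq_zero] at hind
    have h0 := hind Finset.univ (fun i => ∑ α, g (i, α) • f i α) (fun i _ => ?_) hg
    · rintro ⟨i, α⟩
      exact Fintype.linearIndependent_iff.1 (hfli i) (fun α => g (i, α))
        (h0 i (Finset.mem_univ i)) α
    · refine Submodule.sum_mem _ fun α _ => Submodule.smul_mem _ _ ?_
      refine Module.End.mem_eigenspace_iff.2 ?_
      rw [Matrix.toLin'_apply, ← Matrix.mulVec_mulVec, hQf, Matrix.mulVec_smul, Matrix.mulVec_mulVec,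
        Matrix.nonsing_inv_mul _ hBu, Matrix.one_mulVec]
  set b : Fin n → K := fun i => f i 0 ⬝ᵥ B *ᵥ f i 1 with hb
  have hself : ∀ x, x ⬝ᵥ B *ᵥ x = 0 := fun x => self_eq_neg.1 (dotProduct_mulVec_comm hB x x)
  -- Otherwise `f i 0` would be `B`-orthogonal to a whole basis, contradicting `det B ≠ 0`.
  have hb0 : ∀ i, b i ≠ 0 := by
    intro i hi
    have hspan := hli.span_eq_top_of_card_eq_finrank' (by simp [hm, mul_comm])
    have h1 : dotProductBilin K K (f i 0 ᵥ* B) = 0 := by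
      refine LinearMap.ext_on_range hspan fun p => ?_
      change (f i 0 ᵥ* B) ⬝ᵥ f p.1 p.2 = 0
      rw [← Matrix.dotProduct_mulVec]
      obtain ⟨j, β⟩ := p
      by_cases hij : i = j
      · subst hij
        fin_cases β
        · exact hself _
        · exact hi
      · exact horth i j 0 β hij
    have h2 : f i 0 ᵥ* B = 0 := dotProduct_eq_zero _ fun w => LinearMap.congr_fun h1 w
    exact (hfli i).ne_zero 0 (Matrix.eq_zero_of_vecMul_eq_zero hdet h2)
  let F : Matrix m (Fin n × Fin 2) K :=
    Matrix.of fun x p => (![1, (b p.1)⁻¹] p.2 : K) * f p.1 p.2 x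
  have hFB : Fᵀ * B * F = sumForm K n := by
    ext ⟨i, α⟩ ⟨j, β⟩
    have h1 : (Fᵀ * B * F) (i, α) (j, β) =
        (![1, (b i)⁻¹] α : K) * (![1, (b j)⁻¹] β : K) * (f i α ⬝ᵥ B *ᵥ f j β) := by
      have : ∀ p, (fun x => F x p) = (![1, (b p.1)⁻¹] p.2 : K) • f p.1 p.2 := fun p => by
        ext x; simp [F]
      have h2 : (Fᵀ * B * F) (i, α) (j, β) =
          (fun x => F x (i, α)) ⬝ᵥ B *ᵥ (fun x => F x (j, β)) := by
        rw [Matrix.mul_assoc]; rfl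
      rw [h2, this, this, Matrix.mulVec_smul, dotProduct_smul, smul_dotProduct, smul_eq_mul,
        smul_eq_mul]
      ring
    rw [h1]
    by_cases hij : i = j
    · subst hij
      have hb' := hb0 i
      fin_cases α <;> fin_cases β
      · simp [planeForm, hself]
      · simpa [planeForm] using inv_mul_cancel₀ hb'
      · rw [dotProduct_mulVec_comm hB]
        simpa [planeForm] using inv_mul_cancel₀ hb'
      · simp [planeForm, hself]
    · simp [horth i j α β hij, hij]
  have hFQ : Fᵀ * Q * F = diagonal a ⊗ₖ planeForm K := by
    have h1 : Q * F = B * F * diagonal fun p : Fin n × Fin 2 => a p.1 := by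
      ext x p
      have h2 := congrFun (hQf p.1 p.2) x
      rw [Matrix.mul_diagonal]
      simp only [Matrix.mulVec, dotProduct, Pi.smul_apply, smul_eq_mul] at h2
      simp only [Matrix.mul_apply, F, Matrix.of_apply, mul_left_comm (Q x _),
        mul_left_comm (B x _), ← Finset.mul_sum, h2]
      ring
    rw [Matrix.mul_assoc, h1, ← Matrix.mul_assoc, ← Matrix.mul_assoc, hFB]
    ext p q
    rw [Matrix.mul_diagonal]
    simp only [Matrix.kroneckerMap_apply, Matrix.one_apply, Matrix.diagonal_apply]
    split_ifs with h
    · rw [h]; ring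
    · simp
  -- From `Fᵀ B F = D` and `Dᵀ D = 1` the inverse of `Fᵀ` is `Bᵀ F D`; this is the required `G`.
  have hHG : Fᵀ * (Bᵀ * F * sumForm K n) = 1 := by
    have h1 : Fᵀ * Bᵀ * F = (sumForm K n)ᵀ := by
      rw [← hFB]; simp only [Matrix.transpose_mul, Matrix.transpose_transpose, Matrix.mul_assoc]
    rw [← Matrix.mul_assoc, ← Matrix.mul_assoc, h1]
    simpa using sumForm_transpose_mul (K := K) (n := n) fun _ => 1
  have hGH := (Matrix.mul_eq_one_comm_of_card_eq _ _ _ (by simp [hm, mul_comm])).1 hHG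
  have key : ∀ (S : Matrix m m K) (T : Matrix (Fin n × Fin 2) (Fin n × Fin 2) K), Fᵀ * S * F = T →
      S = (Bᵀ * F * sumForm K n) * T * (Bᵀ * F * sumForm K n)ᵀ := by
    intro S T hT
    generalize Bᵀ * F * sumForm K n = G at hGH
    rw [← hT]
    calc S = (G * Fᵀ) * S * (G * Fᵀ)ᵀ := by simp [hGH]
      _ = _ := by simp only [Matrix.transpose_mul, Matrix.transpose_transpose, Matrix.mul_assoc]
  exact ⟨_, Fᵀ, hHG, hGH, key _ _ hFQ, key _ _ hFB⟩

open Polynomial in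
-- Each root has multiplicity at most the total number of roots.
theorem dvd_prod_roots_pow [DecidableEq K] {p : K[X]} (hp : p.Monic) (hs : p.Splits) :
    p ∣ (∏ μ ∈ p.roots.toFinset, (X - C μ)) ^ p.roots.card := by
  have h : (p.roots.map fun μ => X - C μ).prod ∣
      (∏ μ ∈ p.roots.toFinset, (X - C μ)) ^ p.roots.card := by
    rw [Finset.prod_multiset_map_count, ← Finset.prod_pow]
    exact Finset.prod_dvd_prod_of_dvd _ _ fun μ _ => pow_dvd_pow _ (Multiset.count_le_card _ _)
  rwa [← hs.eq_prod_roots_of_monic hp] at h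

/-- A matrix has at least `n` eigenvalues if the matrix of the first traces of its powers is
nondegenerate. -/
theorem exists_eigenvalues_of_det_trace_pow_ne_zero [IsAlgClosed K] {N : Matrix m m K}
    (hN : (Matrix.of fun i j : Fin n => (N ^ ((i : ℕ) + j)).trace).det ≠ 0) :
    ∃ a : Fin n → K, Function.Injective a ∧ ∀ i, (N - a i • (1 : Matrix m m K)).det = 0 := by
  classical
  open Polynomial in
  set s : Finset K := N.charpoly.roots.toFinset with hs
  have hcard : n ≤ s.card := by
    by_contra! hlt
    -- With fewer than `n` eigenvalues, `q` has degree below `n` and `q(N)` is nilpotent. Then every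
    -- `tr (q(N) N^j)` vanishes, so the coefficients of the monic `q` form a nonzero left null
    -- vector of the Hankel matrix.
    set q : K[X] := ∏ μ ∈ s, (X - C μ) with hq
    have hqm : q.Monic := monic_prod_X_sub_C _ _
    have hqd : q.natDegree = s.card := natDegree_finsetProd_X_sub_C_eq_card _ _
    have hdvd : N.charpoly ∣ q ^ N.charpoly.roots.card :=
      dvd_prod_roots_pow N.charpoly_monic (IsAlgClosed.splits _)
    have hnil : IsNilpotent (aeval N q) := by
      refine ⟨N.charpoly.roots.card, ?_⟩
      rw [← map_pow]
      obtain ⟨r, hr⟩ := hdvd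
      rw [hr, map_mul, Matrix.aeval_self_charpoly, zero_mul]
    have htr : ∀ j, (aeval N q * N ^ j).trace = 0 := fun j => by
      have hc : Commute (aeval N q) (N ^ j) := by
        have := (Commute.all q (X ^ j)).map (aeval N)
        simpa using this
      exact (Matrix.isNilpotent_trace_of_isNilpotent (hc.isNilpotent_mul_right hnil)).eq_zero
    have h0 : (fun i : Fin n => q.coeff i) = 0 := by
      refine Matrix.eq_zero_of_vecMul_eq_zero hN ?_
      ext j
      have h := htr j
      rw [aeval_eq_sum_range' (hqd.trans_lt hlt), Finset.sum_mul, Matrix.trace_sum,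
        Finset.sum_range] at h
      simpa [Matrix.vecMul, dotProduct, pow_add] using h
    have h1 := congrFun h0 ⟨s.card, hlt⟩
    simp only [← hqd, Pi.zero_apply] at h1
    exact one_ne_zero (hqm.coeff_natDegree.symm.trans h1)
  obtain ⟨e⟩ : Nonempty (Fin n ↪ s) := Function.Embedding.nonempty_of_card_le (by simpa using hcard)
  refine ⟨fun i => e i, Subtype.val_injective.comp e.injective, fun i => ?_⟩
  have h := (Polynomial.mem_roots'.1 (Multiset.mem_toFinset.1 (e i).2)).2
  rw [Polynomial.IsRoot, Matrix.eval_charpoly] at h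
  rw [← neg_sub, Matrix.det_neg, Matrix.smul_one_eq_diagonal]
  exact mul_eq_zero_of_right _ h

end SimultaneousNormalForm

end JK

/-! ### Genericity -/

namespace JK

section GenericPair

open Matrix Kronecker

variable {m : Type*} [Fintype m] [DecidableEq m]

/-- A polynomial in the entries of `Q` and `B` that vanishes unless `B` is nondegenerate and the
pencil `Q - μ B` has at least `n` characteristic ratios. -/
def pencilDiscr {R : Type*} [CommRing R] (n : ℕ) (Q B : Matrix m m R) : R :=
  B.det * (Matrix.of fun i j : Fin n => ((B.adjugate * Q) ^ ((i : ℕ) + j)).trace).det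

/-- The adjugate replaces the inverse, so only ring operations occur. This lets `pencilDiscr` be
formed over a polynomial ring and then evaluated. -/
theorem map_pencilDiscr {R S : Type*} [CommRing R] [CommRing S] (φ : R →+* S) (n : ℕ)
    (Q B : Matrix m m R) : φ (pencilDiscr n Q B) = pencilDiscr n (φ.mapMatrix Q) (φ.mapMatrix B) := by
  rw [pencilDiscr, pencilDiscr, map_mul, RingHom.map_det, RingHom.map_det]
  congr 2
  ext i j
  simp only [RingHom.mapMatrix_apply, Matrix.map_apply, Matrix.of_apply]
  rw [← RingHom.mapMatrix_apply, ← RingHom.mapMatrix_apply, ← RingHom.map_adjugate, ← map_mul,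
    ← map_pow]
  simp [Matrix.trace]

variable {K : Type*} [Field K] {n : ℕ}

/-- As `adj B = det B · B⁻¹`, the eigenvalues of `adj(B) Q` are the characteristic ratios scaled by
`det B`. -/
theorem exists_roots_of_pencilDiscr_ne_zero [IsAlgClosed K] {Q B : Matrix m m K}
    (h : pencilDiscr n Q B ≠ 0) :
    B.det ≠ 0 ∧ ∃ a : Fin n → K, Function.Injective a ∧ ∀ i, (Q - a i • B).det = 0 := by
  have hB := left_ne_zero_of_mul h
  obtain ⟨a, ha, ha'⟩ := exists_eigenvalues_of_det_trace_pow_ne_zero (right_ne_zero_of_mul h)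
  refine ⟨hB, fun i => a i / B.det, fun i j hij => ha ?_, fun i => ?_⟩
  · exact (div_left_inj' hB).1 hij
  · have h1 : B * (B.adjugate * Q - a i • (1 : Matrix m m K)) =
        B.det • (Q - (a i / B.det) • B) := by
      rw [Matrix.mul_sub, ← Matrix.mul_assoc, Matrix.mul_adjugate, smul_sub, smul_smul,
        mul_div_cancel₀ _ hB]
      simp
    have h2 := congrArg Matrix.det h1
    rw [Matrix.det_mul, ha' i, mul_zero, Matrix.det_smul] at h2
    exact (mul_eq_zero.1 h2.symm).resolve_left (pow_ne_zero _ hB)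

/-- The witness is the model pair with ratios `0, …, n - 1`. Every eigenvalue is double, so the
Hankel matrix is `2 VᵀV` with `V` a Vandermonde matrix at distinct nodes. -/
theorem exists_pencilDiscr_ne_zero [CharZero K] (e : m ≃ Fin n × Fin 2) :
    ∃ Q B : skewForms K m, pencilDiscr n (Q : Matrix m m K) (B : Matrix m m K) ≠ 0 := by
  let a : Fin n → K := fun i => (i : ℕ)
  have ha : Function.Injective a := fun i j h => Fin.ext (Nat.cast_injective h)
  have hskew : ∀ c : Fin n → K, (diagonal c ⊗ₖ planeForm K).submatrix e e ∈ skewForms K m := by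
    intro c
    change ((diagonal c ⊗ₖ planeForm K).submatrix e e)ᵀ =
      -(diagonal c ⊗ₖ planeForm K).submatrix e e
    rw [Matrix.transpose_submatrix, kronecker_planeForm_transpose]
    rfl
  let Q : skewForms K m := ⟨_, hskew a⟩
  let B : skewForms K m := ⟨_, hskew fun _ => 1⟩
  have hmul : ∀ c : Fin n → K, (B : Matrix m m K)ᵀ * (diagonal c ⊗ₖ planeForm K).submatrix e e =
      diagonal fun x => c (e x).1 := by
    intro c
    change ((diagonal (fun _ : Fin n => (1 : K)) ⊗ₖ planeForm K).submatrix e e)ᵀ * _ = _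
    rw [Matrix.transpose_submatrix, Matrix.submatrix_mul_equiv, Matrix.diagonal_one,
      sumForm_transpose_mul, Matrix.submatrix_diagonal_equiv]
    rfl
  have hBB : (B : Matrix m m K)ᵀ * (B : Matrix m m K) = 1 := by
    rw [← Matrix.diagonal_one]
    exact hmul fun _ => 1
  have hdet : (B : Matrix m m K).det ≠ 0 := by
    intro h
    have := congrArg Matrix.det hBB
    rw [Matrix.det_mul, h, mul_zero, Matrix.det_one] at this
    exact zero_ne_one this
  set δ := (B : Matrix m m K).det with hδ
  have hadj : (B : Matrix m m K).adjugate = δ • (B : Matrix m m K)ᵀ := by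
    calc _ = ((B : Matrix m m K)ᵀ * (B : Matrix m m K)) * (B : Matrix m m K).adjugate := by
          rw [hBB, Matrix.one_mul]
      _ = _ := by rw [Matrix.mul_assoc, Matrix.mul_adjugate]; simp [hδ]
  have hN : (B : Matrix m m K).adjugate * (Q : Matrix m m K) = diagonal fun x => δ * a (e x).1 := by
    rw [hadj, Matrix.smul_mul]
    change δ • ((B : Matrix m m K)ᵀ * (diagonal a ⊗ₖ planeForm K).submatrix e e) = _
    rw [hmul, ← Matrix.diagonal_smul]
    rfl
  refine ⟨Q, B, mul_ne_zero hdet ?_⟩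
  have hV : (Matrix.of fun i j : Fin n => (((B : Matrix m m K).adjugate * (Q : Matrix m m K)) ^
      ((i : ℕ) + j)).trace) =
      (2 : K) • ((vandermonde fun i => δ * a i)ᵀ * vandermonde fun i => δ * a i) := by
    ext i j
    rw [Matrix.of_apply, hN, Matrix.diagonal_pow, Matrix.trace_diagonal, Matrix.smul_apply,
      Matrix.mul_apply, ← e.symm.sum_comp, Fintype.sum_prod_type]
    simp [Matrix.vandermonde_apply, pow_add, Finset.mul_sum, two_mul, Finset.sum_add_distrib]
  have hvand : (vandermonde fun i => δ * a i).det ≠ 0 :=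
    Matrix.det_vandermonde_ne_zero_iff.2 ((mul_right_injective₀ hdet).comp ha)
  rw [hV, Matrix.det_smul, Matrix.det_mul, Matrix.det_transpose]
  exact mul_ne_zero (pow_ne_zero _ two_ne_zero) (mul_ne_zero hvand hvand)

variable (m K) in
/-- The entry at `(i, j)` of a skew-symmetric matrix, as a linear functional. -/
def skewEntry (i j : m) : Module.Dual K (skewForms K m) :=
  Matrix.entryLinearMap K K i j ∘ₗ (skewForms K m).subtype

/-- A property of pairs of skew-symmetric matrices is generic if it follows from the nonvanishing
of `pencilDiscr`. -/
theorem generic_of_pencilDiscr [CharZero K] (e : m ≃ Fin n × Fin 2)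
    {P : skewForms K m × skewForms K m → Prop}
    (hP : ∀ w, pencilDiscr n (w.1 : Matrix m m K) (w.2 : Matrix m m K) ≠ 0 → P w) :
    Generic (K := K) P := by
  -- `pencilDiscr` of two matrices of indeterminates, each labelled by the functional that reads off
  -- the corresponding entry.
  let p : MvPolynomial (Module.Dual K (skewForms K m × skewForms K m)) K := pencilDiscr n
    (Matrix.of fun i j => .X (skewEntry m K i j ∘ₗ LinearMap.fst K _ _))
    (Matrix.of fun i j => .X (skewEntry m K i j ∘ₗ LinearMap.snd K _ _))
  have hp : ∀ w : skewForms K m × skewForms K m,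
      MvPolynomial.eval (fun φ : Module.Dual K (skewForms K m × skewForms K m) => φ w) p =
        pencilDiscr n (w.1 : Matrix m m K) (w.2 : Matrix m m K) := by
    intro w
    refine (map_pencilDiscr _ _ _ _).trans ?_
    congr 1 <;>
    · ext i j
      simp [skewEntry]
  obtain ⟨Q, B, h⟩ := exists_pencilDiscr_ne_zero (K := K) e
  exact ⟨p, ⟨(Q, B), by rwa [hp]⟩, fun w hw => hP w (by rwa [← hp])⟩

end GenericPair

end JK

theorem theoremT {K : Type*} [Field K] [IsAlgClosed K] [CharZero K] (n : ℕ) (hn : 1 ≤ n) :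
    Multiset.card (Multiset.replicate (3 * n) 1 + Multiset.replicate (2 * n * (n - 1)) 2)
      = n * (2 * n + 1) ∧
    JK.IsJKInvariant (JK.slCongruence K (Fin (2 * n)))
      { jordan := 0
        horizontal := Multiset.replicate (3 * n) 1 + Multiset.replicate (2 * n * (n - 1)) 2
        vertical := {n} } := by
  -- The block `vertical k` has height `k + 1`, so the vertical index `n` means `k = n - 1`.
  obtain ⟨k, rfl⟩ : ∃ k, n = k + 1 := ⟨n - 1, by omega⟩
  refine ⟨?_, ?_⟩
  · simp only [Multiset.card_add, Multiset.card_replicate, Nat.add_sub_cancel]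
    ring
  · refine JK.generic_of_pencilDiscr (n := k + 1)
      ((finProdFinEquiv (m := 2) (n := k + 1)).symm.trans (Equiv.prodComm _ _)) ?_
    rintro ⟨Q, B⟩ h
    obtain ⟨hB, a, ha, hroot⟩ := JK.exists_roots_of_pencilDiscr_ne_zero h
    obtain ⟨G, H, hHG, hGH, hQG, hBG⟩ :=
      JK.exists_simultaneous_normalForm (Fintype.card_fin _) Q.2 B.2 hB ha hroot
    refine ⟨_, inferInstance, inferInstance, _,
      JK.isNormalForm_orbitMap hHG hGH (Fintype.card_fin _) ha hQG hBG, ?_⟩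
    rw [JK.algebraicTypeOfBlocks_kroneckerBlocks, JK.card_upperIndex, Fintype.card_prod,
      Fintype.card_fin, Fintype.card_fin, mul_comm (k + 1) 3]
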